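/- All graphs are finite, simple and undirected, with at least one vertex. For a connected graph $G$ let $d$ be its distance and $e(u)=\max_v d(u,v)$; the eccentricity matrix $\epsilon(G)$ has $(u,v)$ entry $d(u,v)$ if $d(u,v)=\min\{e(u),e(v)\}$, and $0$ otherwise. The $\epsilon$-spectrum of $G$ is the multiset of eigenvalues of $\epsilon(G)$, with algebraic multiplicity. The central graph $C[G]$ is obtained from $G$ by inserting a new vertex on every edge of $G$ and joining every two distinct original vertices that are not adjacent in $G$. The central vertex-edge join $C[G_1]\vee(G_2^V\cup G_3^E)$ is obtained from the disjoint union of $C[G_1]$, $G_2$ and $G_3$ by joining every original vertex of $G_1$ to every vertex of $G_2$, and every inserted vertex of $C[G_1]$ to every vertex of $G_3$. **Theorem.** For $i=1,2,3$ let $G_i$ be an $r_i$-regular graph with $p_i\ge 1$ vertices and $q_i$ edges, where $G_1$ is triangle-free and $r_1\ge 1$. Let $\lambda_{11}\ge\lambda_{12}\ge\dots\ge\lambda_{1p_1}$ be the eigenvalues of the adjacency matrix of $G_1$, with multiplicity (so $\lambda_{11}=r_1$). Then $C[G_1]\vee(G_2^V\cup G_3^E)$ is connected, and its $\epsilon$-spectrum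 consists, with multiplicities, of 1. $(-1+\lambda_{1j})\pm\sqrt{(1+\lambda_{1j})^2+4(\lambda_{1j}+r_1)}$ for $j=2,3,\dots,p_1$; 2. $-2$ with multiplicity $q_1-p_1$; 3. $0$ with multiplicity $p_2+p_3-2$; 4. the four eigenvalues (with multiplicity) of the matrix $$\begin{pmatrix}2r_1&2(q_1-r_1)&0&2p_3\\ 2(p_1-2)&2(q_1-1)&2p_2&0\\ 0&2q_1&0&3p_3\\ 2p_1&0&3p_2&0\end{pmatrix}.$$ If $q_1<p_1$ (which happens only for $r_1=1$), item 2 means that $p_1-q_1$ copies of $-2$ are to be removed from the multiset union of the lists in items 1, 3 and 4. -/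

import Mathlib

noncomputable section

namespace CentralJoin

/-- The central graph `C[G]`: one new vertex is inserted on every edge of `G`, and any two distinct
original vertices that are not adjacent in `G` are joined. -/
def centralGraph {V : Type*} (G : SimpleGraph V) : SimpleGraph (V ⊕ G.edgeSet) where
  Adj
    | .inl u, .inl v => u ≠ v ∧ ¬ G.Adj u v
    | .inl u, .inr e => u ∈ (e : Sym2 V)
    | .inr e, .inl u => u ∈ (e : Sym2 V)
    | .inr _, .inr _ => False
  symm := ⟨by
    rintro (u | e) (v | f) h
    · exact ⟨h.1.symm, fun h' => h.2 h'.symm⟩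
    · exact h
    · exact h
    · exact h⟩
  loopless := ⟨by
    rintro (u | e) h
    · exact h.1 rfl
    · exact h⟩

/-- The central vertex-edge join `C[G₁] ∨ (G₂^V ∪ G₃^E)`: the disjoint union of `C[G₁]`, `G₂` and
`G₃`, together with all edges between original vertices of `G₁` and vertices of `G₂`, and all edges
between the inserted vertices of `C[G₁]` and vertices of `G₃`. -/
def centralVertexEdgeJoin {V₁ V₂ V₃ : Type*} (G₁ : SimpleGraph V₁) (G₂ : SimpleGraph V₂)
    (G₃ : SimpleGraph V₃) : SimpleGraph ((V₁ ⊕ G₁.edgeSet) ⊕ (V₂ ⊕ V₃)) where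
  Adj
    | .inl x, .inl y => (centralGraph G₁).Adj x y
    | .inl (.inl _), .inr (.inl _) => True
    | .inr (.inl _), .inl (.inl _) => True
    | .inl (.inr _), .inr (.inr _) => True
    | .inr (.inr _), .inl (.inr _) => True
    | .inr (.inl a), .inr (.inl b) => G₂.Adj a b
    | .inr (.inr a), .inr (.inr b) => G₃.Adj a b
    | _, _ => False
  symm := ⟨by
    rintro ((u | e) | (a | b)) ((v | f) | (c | d)) h
    all_goals first
      | exact h
      | exact SimpleGraph.Adj.symm h⟩
  loopless := ⟨by
    rintro ((u | e) | (a | b)) h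
    · exact (centralGraph G₁).irrefl h
    · exact (centralGraph G₁).irrefl h
    · exact G₂.irrefl h
    · exact G₃.irrefl h⟩

open Classical in
/-- The eccentricity matrix `ε(G)` of a (connected) graph: the `(u, v)` entry is `d(u, v)` if
`d(u, v) = min {e(u), e(v)}`, and `0` otherwise. -/
def eccentricityMatrix {V : Type*} (G : SimpleGraph V) : Matrix V V ℝ :=
  Matrix.of fun u v =>
    if G.edist u v = min (G.eccent u) (G.eccent v) then (G.dist u v : ℝ) else 0

/-- The multiset of the real eigenvalues of a real square matrix, each repeated according to its
algebraic multiplicity as a root of the characteristic polynomial. -/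
def eigenvalueMultiset {n : Type*} [Fintype n] [DecidableEq n] (M : Matrix n n ℝ) : Multiset ℝ :=
  M.charpoly.roots

/-- The `ε`-spectrum of `G`: the eigenvalues of `ε(G)` with algebraic multiplicity. -/
def eccentricitySpectrum {V : Type*} [Fintype V] [DecidableEq V] (G : SimpleGraph V) :
    Multiset ℝ :=
  eigenvalueMultiset (eccentricityMatrix G)

/-- The `4 × 4` quotient matrix. -/
def quotientMatrix (p₁ q₁ r₁ p₂ p₃ : ℝ) : Matrix (Fin 4) (Fin 4) ℝ :=
  !![2 * r₁,        2 * (q₁ - r₁), 0,      2 * p₃;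
     2 * (p₁ - 2),  2 * (q₁ - 1),  2 * p₂, 0;
     0,             2 * q₁,        0,      3 * p₃;
     2 * p₁,        0,             3 * p₂, 0]

end CentralJoin

end

/-! In the join, vertices of C[G₁] have eccentricity 2 and those of G₂ and G₃ have eccentricity 3.
Distances inside G₂ or G₃ are at most 2, so the structure of these two graphs disappears. This gives
ε = S + UW. Here UW is constant on the blocks cut out by the four kinds of vertices, and S lives on
C[G₁] with blocks 2A, -2R, -2Rᵀ, -2I (A adjacency, R incidence). By regularity the block indicators
U satisfy SU = UB for a 4 × 4 matrix B, so `det_sub_mul_mul_det` yields χ_ε χ_B = χ_S χ_Q, with Q =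
B + WU the quotient matrix.

A Schur complement and RRᵀ = A + r₁I give χ_S, up to powers of t and t + 2, as the product of t² -
(2x - 2)t - 4(2x + r₁) over the adjacency eigenvalues x. The factor at x = r₁, times t², is χ_B and
cancels. Keeping (t + 2)^p₁ on the left instead of dividing gives one polynomial identity for both
signs of q₁ - p₁; taking roots of both sides gives the multisets. -/

open Polynomial

namespace CentralJoin

/-! ### Determinant identities -/

section Determinants

variable {m n k R : Type*} [Fintype m] [DecidableEq m] [Fintype n] [DecidableEq n]
  [Fintype k] [DecidableEq k] [CommRing R]

/-- A determinant formula for the perturbation of `S` by a product `U * W`, when the columns of `U`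
span an `S`-invariant module on which `S` acts through `B`. -/
theorem det_sub_mul_mul_det (S : Matrix n n R) (U : Matrix n k R) (W : Matrix k n R)
    (B : Matrix k k R) (h : S * U = U * B) :
    (S - U * W).det * B.det = S.det * (B - W * U).det := by
  have key : Matrix.fromBlocks S U W 1 * Matrix.fromBlocks 1 (-U) 0 B =
      Matrix.fromBlocks S 0 W (B - W * U) := by
    rw [Matrix.fromBlocks_multiply]
    congr 1
    · simp
    · simp [h]
    · simp
    · simp; abel
  have := congrArg Matrix.det key
  rwa [Matrix.det_mul, Matrix.det_fromBlocks_one₂₂, Matrix.det_fromBlocks_zero₂₁,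
    Matrix.det_fromBlocks_zero₁₂, Matrix.det_one, one_mul] at this

/-- Schur complement with the pivot `s` cleared from denominators, so that it also holds at `s = 0`.
-/
theorem det_fromBlocks_smul_one_mul_pow (A : Matrix m m R) (B : Matrix m n R) (C : Matrix n m R)
    (s : R) :
    (Matrix.fromBlocks A B C (s • 1)).det * s ^ Fintype.card m =
      (s • A - B * C).det * s ^ Fintype.card n := by
  have key : Matrix.fromBlocks A B C (s • 1) * Matrix.fromBlocks (s • 1) 0 (-C) 1 =
      Matrix.fromBlocks (s • A - B * C) B 0 (s • 1) := by
    rw [Matrix.fromBlocks_multiply]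
    congr 1 <;> simp [sub_eq_add_neg]
  have := congrArg Matrix.det key
  rwa [Matrix.det_mul, Matrix.det_fromBlocks_zero₁₂, Matrix.det_fromBlocks_zero₂₁,
    Matrix.det_smul, Matrix.det_smul, Matrix.det_one, Matrix.det_one, mul_one, mul_one,
    mul_one] at this

/-- For `b ≠ 0` this is `b ^ n` times the characteristic polynomial at `a / b`. The case `b = 0` is
needed because the later coefficient `2 * t + 8` can vanish. -/
theorem det_smul_one_sub_smul {K : Type*} [Field K] (A : Matrix n n K) (s : Multiset K)
    (hs : A.charpoly = (s.map fun a => X - C a).prod) (a b : K) :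
    (a • (1 : Matrix n n K) - b • A).det = (s.map fun x => a - b * x).prod := by
  have hcard : Multiset.card s = Fintype.card n := by
    rw [← A.charpoly_natDegree_eq_dim, hs, natDegree_multiset_prod_X_sub_C_eq_card]
  by_cases hb : b = 0
  · subst hb
    simp [hcard]
  · have h1 : a • (1 : Matrix n n K) - b • A = b • (Matrix.scalar n (a / b) - A) := by
      rw [smul_sub, Matrix.scalar_apply, ← Matrix.smul_one_eq_diagonal, smul_smul,
        mul_div_cancel₀ _ hb]
    have h2 : s.map (fun x => a - b * x) = s.map fun x => b * (a / b - x) :=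
      Multiset.map_congr rfl fun x _ => by rw [mul_sub, mul_div_cancel₀ _ hb]
    rw [h1, Matrix.det_smul, ← Matrix.eval_charpoly, hs, eval_multiset_prod, h2,
      Multiset.prod_map_mul, Multiset.map_const', Multiset.prod_replicate, hcard,
      Multiset.map_map]
    simp

end Determinants

/-! ### Adjacency eigenvalues of a regular graph -/

/-- The spectrum of the adjacency matrix of an `r`-regular graph lies in `[-r, r]`. -/
theorem abs_le_of_mem_eigenvalueMultiset {V : Type*} [Fintype V] [DecidableEq V]
    (G : SimpleGraph V) [DecidableRel G.Adj] {r : ℕ} (hG : G.IsRegularOfDegree r) {x : ℝ}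
    (hx : x ∈ eigenvalueMultiset (G.adjMatrix ℝ)) : |x| ≤ r := by
  have hx' := isRoot_of_mem_roots hx
  have hev : Module.End.HasEigenvalue (Matrix.toLin' (G.adjMatrix ℝ)) x := by
    rw [Module.End.hasEigenvalue_iff_isRoot_charpoly, Matrix.charpoly_toLin']
    exact hx'
  -- Gershgorin: the disc is centred at the zero diagonal entry, and its radius is at most the row
  -- sum `r`.
  obtain ⟨v, hv⟩ := eigenvalue_mem_ball hev
  rw [Metric.mem_closedBall, SimpleGraph.adjMatrix_apply, if_neg (G.irrefl), Real.dist_eq,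
    sub_zero] at hv
  refine hv.trans ?_
  calc ∑ j ∈ Finset.univ.erase v, ‖G.adjMatrix ℝ v j‖
      ≤ ∑ j, ‖G.adjMatrix ℝ v j‖ :=
        Finset.sum_le_sum_of_subset_of_nonneg (Finset.erase_subset _ _) fun _ _ _ => norm_nonneg _
    _ = ∑ j, G.adjMatrix ℝ v j := by
        refine Finset.sum_congr rfl fun j _ => ?_
        rw [SimpleGraph.adjMatrix_apply]; split_ifs <;> simp
    _ = r := by
        have := G.adjMatrix_mulVec_const_apply_of_regular (α := ℝ) (a := 1) hG (v := v)
        simpa [Matrix.mulVec, dotProduct] using this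

theorem degree_mem_eigenvalueMultiset {V : Type*} [Fintype V] [DecidableEq V] [Nonempty V]
    (G : SimpleGraph V) [DecidableRel G.Adj] {r : ℕ} (hG : G.IsRegularOfDegree r) :
    (r : ℝ) ∈ eigenvalueMultiset (G.adjMatrix ℝ) := by
  rw [eigenvalueMultiset, mem_roots (Matrix.charpoly_monic _).ne_zero, ← Matrix.charpoly_toLin',
    ← Module.End.hasEigenvalue_iff_isRoot_charpoly]
  refine Module.End.hasEigenvalue_of_hasEigenvector (x := Function.const V (1 : ℝ)) ⟨?_, ?_⟩
  · rw [Module.End.mem_eigenspace_iff]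
    ext v
    rw [Matrix.toLin'_apply, SimpleGraph.adjMatrix_mulVec_const_apply_of_regular hG]
    simp
  · obtain ⟨v⟩ := ‹Nonempty V›
    exact fun h => one_ne_zero (congrFun h v)

/-! ### Distances and eccentricities in the join -/

section Distances

variable {V₁ V₂ V₃ : Type*} (G₁ : SimpleGraph V₁) (G₂ : SimpleGraph V₂) (G₃ : SimpleGraph V₃)

theorem edist_le_two_of_adj_of_adj {V : Type*} {G : SimpleGraph V} {u w v : V} (h₁ : G.Adj u w)
    (h₂ : G.Adj w v) : G.edist u v ≤ 2 :=
  G.edist_le (.cons h₁ (.cons h₂ .nil))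

theorem edist_eq_two {V : Type*} {G : SimpleGraph V} {u v : V} (w : V) (hne : u ≠ v)
    (h : ¬ G.Adj u v) (h₁ : G.Adj u w) (h₂ : G.Adj w v) : G.edist u v = 2 :=
  G.edist_eq_two_iff.2 ⟨hne, h, w, h₁, h₂.symm⟩

local notation "H" => centralVertexEdgeJoin G₁ G₂ G₃

theorem edist_vertex_vertex [Nonempty V₂] {u v : V₁} (h : G₁.Adj u v) :
    (H).edist (.inl (.inl u)) (.inl (.inl v)) = 2 := by
  obtain ⟨a⟩ := ‹Nonempty V₂›
  refine edist_eq_two (.inr (.inl a)) (by simpa using h.ne) ?_ trivial trivial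
  exact fun h' => h'.2 h

theorem edist_vertex_vertex_of_not_adj {u v : V₁} (hne : u ≠ v) (h : ¬ G₁.Adj u v) :
    (H).edist (.inl (.inl u)) (.inl (.inl v)) = 1 :=
  SimpleGraph.edist_eq_one_iff_adj.2 ⟨hne, h⟩

/-- Without triangles, `u` misses at least one end of `e`; that end is joined to `u` in the central
graph and lies on `e`. -/
theorem edist_vertex_edge (htri : G₁.CliqueFree 3) {u : V₁} {e : G₁.edgeSet}
    (h : u ∉ (e : Sym2 V₁)) : (H).edist (.inl (.inl u)) (.inl (.inr e)) = 2 := by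
  classical
  obtain ⟨e, he⟩ := e
  induction e with | _ v w
  rw [Sym2.mem_iff, not_or] at h
  rw [SimpleGraph.mem_edgeSet] at he
  have : ¬ G₁.Adj u v ∨ ¬ G₁.Adj u w := by
    by_contra! h'
    exact htri {u, v, w} (SimpleGraph.is3Clique_triple_iff.2 ⟨h'.1, h'.2, he⟩)
  have hn : ¬ (H).Adj (.inl (.inl u)) (.inl (.inr ⟨s(v, w), he⟩)) := fun h' =>
    (Sym2.mem_iff.1 h').elim h.1 h.2
  obtain h' | h' := this
  · exact edist_eq_two (.inl (.inl v)) (by simp) hn ⟨h.1, h'⟩ (Sym2.mem_mk_left v w)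
  · exact edist_eq_two (.inl (.inl w)) (by simp) hn ⟨h.2, h'⟩ (Sym2.mem_mk_right v w)

theorem edist_vertex_edge_of_mem {u : V₁} {e : G₁.edgeSet}
    (h : u ∈ (e : Sym2 V₁)) : (H).edist (.inl (.inl u)) (.inl (.inr e)) = 1 :=
  SimpleGraph.edist_eq_one_iff_adj.2 h

theorem edist_vertex_left (u : V₁) (a : V₂) :
    (H).edist (.inl (.inl u)) (.inr (.inl a)) = 1 :=
  SimpleGraph.edist_eq_one_iff_adj.2 trivial

theorem edist_vertex_right (hdeg : ∀ u, ∃ v, G₁.Adj u v) (u : V₁) (b : V₃) :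
    (H).edist (.inl (.inl u)) (.inr (.inr b)) = 2 := by
  obtain ⟨v, hv⟩ := hdeg u
  exact edist_eq_two (.inl (.inr ⟨s(u, v), hv⟩)) (by simp) (fun h => h)
    (Sym2.mem_mk_left u v) trivial

theorem edist_edge_edge [Nonempty V₃] {e f : G₁.edgeSet} (h : e ≠ f) :
    (H).edist (.inl (.inr e)) (.inl (.inr f)) = 2 := by
  obtain ⟨b⟩ := ‹Nonempty V₃›
  exact edist_eq_two (.inr (.inr b)) (by simpa using h) (fun h => h) trivial trivial

theorem edist_edge_left (e : G₁.edgeSet) (a : V₂) :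
    (H).edist (.inl (.inr e)) (.inr (.inl a)) = 2 := by
  obtain ⟨e, he⟩ := e
  induction e with | _ v w
  exact edist_eq_two (.inl (.inl v)) (by simp) (fun h => h) (Sym2.mem_mk_left v w) trivial

theorem edist_edge_right (e : G₁.edgeSet) (b : V₃) :
    (H).edist (.inl (.inr e)) (.inr (.inr b)) = 1 :=
  SimpleGraph.edist_eq_one_iff_adj.2 trivial

theorem edist_left_left_le [Nonempty V₁] (a a' : V₂) :
    (H).edist (.inr (.inl a)) (.inr (.inl a')) ≤ 2 := by
  obtain ⟨u⟩ := ‹Nonempty V₁›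
  have h (x : V₂) : (H).Adj (.inr (.inl x)) (.inl (.inl u)) := trivial
  exact edist_le_two_of_adj_of_adj (h a) (h a').symm

theorem edist_right_right_le [Nonempty G₁.edgeSet] (b b' : V₃) :
    (H).edist (.inr (.inr b)) (.inr (.inr b')) ≤ 2 := by
  obtain ⟨e⟩ := ‹Nonempty G₁.edgeSet›
  have h (x : V₃) : (H).Adj (.inr (.inr x)) (.inl (.inr e)) := trivial
  exact edist_le_two_of_adj_of_adj (h b) (h b').symm

theorem edist_left_right [Nonempty G₁.edgeSet] (a : V₂) (b : V₃) :
    (H).edist (.inr (.inl a)) (.inr (.inr b)) = 3 := by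
  obtain ⟨e, he⟩ := ‹Nonempty G₁.edgeSet›
  induction e with | _ v w
  refine le_antisymm ?_ ?_
  · have h₁ : (H).Adj (.inr (.inl a)) (.inl (.inl v)) := trivial
    have h₂ : (H).Adj (.inl (.inl v)) (.inl (.inr ⟨s(v, w), he⟩)) := Sym2.mem_mk_left v w
    have h₃ : (H).Adj (.inl (.inr ⟨s(v, w), he⟩)) (.inr (.inr b)) := trivial
    exact (H).edist_le (.cons h₁ (.cons h₂ (.cons h₃ .nil)))
  -- Neighbours of `a` lie in V₁ or V₂ and those of `b` are edges or lie in V₃, so there is no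
  -- common one.
  · have : (2 : ℕ∞) < (H).edist (.inr (.inl a)) (.inr (.inr b)) := by
      refine SimpleGraph.two_lt_edist_iff.2 ⟨by simp, fun h => h, ?_⟩
      ext x
      simp only [SimpleGraph.mem_commonNeighbors, Set.mem_empty_iff_false, iff_false, not_and]
      rcases x with (u | e) | (a' | b')
      · exact fun _ h => h
      · exact fun h _ => h
      · exact fun _ h => h
      · exact fun h _ => h
    exact Order.add_one_le_of_lt this

theorem eccent_vertex [Nonempty V₂] [Nonempty V₃] (hdeg : ∀ u, ∃ v, G₁.Adj u v)
    (htri : G₁.CliqueFree 3) (u : V₁) :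
    (H).eccent (.inl (.inl u)) = 2 := by
  refine le_antisymm (iSup_le ?_) ?_
  · rintro ((v | e) | (a | b))
    · by_cases hne : u = v
      · simp [hne]
      by_cases h : G₁.Adj u v
      · rw [edist_vertex_vertex _ _ _ h]
      · rw [edist_vertex_vertex_of_not_adj _ _ _ hne h]; exact one_le_two
    · by_cases h : u ∈ (e : Sym2 V₁)
      · rw [edist_vertex_edge_of_mem _ _ _ h]; exact one_le_two
      · rw [edist_vertex_edge _ _ _ htri h]
    · rw [edist_vertex_left]; exact one_le_two
    · rw [edist_vertex_right _ _ _ hdeg]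
  · obtain ⟨b⟩ := ‹Nonempty V₃›
    rw [← edist_vertex_right G₁ G₂ G₃ hdeg u b]
    exact SimpleGraph.edist_le_eccent

theorem eccent_edge [Nonempty V₂] [Nonempty V₃] (htri : G₁.CliqueFree 3) (e : G₁.edgeSet) :
    (H).eccent (.inl (.inr e)) = 2 := by
  refine le_antisymm (iSup_le ?_) ?_
  · rintro ((v | f) | (a | b))
    · rw [SimpleGraph.edist_comm]
      by_cases h : v ∈ (e : Sym2 V₁)
      · rw [edist_vertex_edge_of_mem _ _ _ h]; exact one_le_two
      · rw [edist_vertex_edge _ _ _ htri h]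
    · by_cases h : e = f
      · simp [h]
      · rw [edist_edge_edge _ _ _ h]
    · rw [edist_edge_left]
    · rw [edist_edge_right]; exact one_le_two
  · obtain ⟨a⟩ := ‹Nonempty V₂›
    rw [← edist_edge_left G₁ G₂ G₃ e a]
    exact SimpleGraph.edist_le_eccent

theorem eccent_left [Nonempty V₁] [Nonempty V₃] [Nonempty G₁.edgeSet] (a : V₂) :
    (H).eccent (.inr (.inl a)) = 3 := by
  refine le_antisymm (iSup_le ?_) ?_
  · have h23 : (2 : ℕ∞) ≤ 3 := by norm_num
    rintro ((v | f) | (a' | b))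
    · rw [SimpleGraph.edist_comm, edist_vertex_left]; norm_num
    · rw [SimpleGraph.edist_comm, edist_edge_left]; exact h23
    · exact (edist_left_left_le _ _ _ a a').trans h23
    · rw [edist_left_right]
  · obtain ⟨b⟩ := ‹Nonempty V₃›
    rw [← edist_left_right G₁ G₂ G₃ a b]
    exact SimpleGraph.edist_le_eccent

theorem eccent_right [Nonempty V₂] [Nonempty G₁.edgeSet] (hdeg : ∀ u, ∃ v, G₁.Adj u v)
    (b : V₃) :
    (H).eccent (.inr (.inr b)) = 3 := by
  refine le_antisymm (iSup_le ?_) ?_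
  · have h23 : (2 : ℕ∞) ≤ 3 := by norm_num
    rintro ((v | f) | (a | b'))
    · rw [SimpleGraph.edist_comm, edist_vertex_right _ _ _ hdeg]; exact h23
    · rw [SimpleGraph.edist_comm, edist_edge_right]; norm_num
    · rw [SimpleGraph.edist_comm, edist_left_right]
    · exact (edist_right_right_le _ _ _ b b').trans h23
  · obtain ⟨a⟩ := ‹Nonempty V₂›
    rw [← edist_left_right G₁ G₂ G₃ a b, SimpleGraph.edist_comm]
    exact SimpleGraph.edist_le_eccent

theorem connected_centralVertexEdgeJoin [Nonempty V₁] [Nonempty V₂] [Nonempty V₃]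
    (hdeg : ∀ u, ∃ v, G₁.Adj u v) (htri : G₁.CliqueFree 3) : (H).Connected := by
  obtain ⟨u⟩ := ‹Nonempty V₁›
  by_contra h
  -- A disconnected graph has only infinite eccentricities, but here one equals 2.
  have := SimpleGraph.eccent_eq_top_of_not_connected h (.inl (.inl u))
  rw [eccent_vertex _ _ _ hdeg htri] at this
  exact ENat.natCast_ne_top 2 this

end Distances

/-! ### Entries of the eccentricity matrix -/

section Matrices

variable {V₁ V₂ V₃ : Type*} [DecidableEq V₁] (G₁ : SimpleGraph V₁) [DecidableRel G₁.Adj]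

/-- The vertex-edge incidence matrix, with columns indexed by the edges only. -/
def edgeIncMatrix : Matrix V₁ G₁.edgeSet ℝ :=
  (G₁.incMatrix ℝ).submatrix id Subtype.val

/-- The part of the eccentricity matrix of the join that is not constant on blocks. -/
def nonconstantPart : Matrix ((V₁ ⊕ G₁.edgeSet) ⊕ (V₂ ⊕ V₃)) ((V₁ ⊕ G₁.edgeSet) ⊕ (V₂ ⊕ V₃)) ℝ :=
  Matrix.fromBlocks
    (Matrix.fromBlocks ((2 : ℝ) • G₁.adjMatrix ℝ) ((-2 : ℝ) • edgeIncMatrix G₁)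
      ((-2 : ℝ) • (edgeIncMatrix G₁).transpose) ((-2 : ℝ) • 1)) 0 0 0

/-- The four kinds of vertices of the join. -/
def blockIndex {α β γ δ : Type*} : (α ⊕ β) ⊕ (γ ⊕ δ) → Fin 4
  | .inl (.inl _) => 0
  | .inl (.inr _) => 1
  | .inr (.inl _) => 2
  | .inr (.inr _) => 3

/-- The coefficients of the part of the eccentricity matrix of the join that is constant on
blocks. -/
def blockCoeff : Matrix (Fin 4) (Fin 4) ℝ :=
  !![0, 2, 0, 2;
     2, 2, 2, 0;
     0, 2, 0, 3;
     2, 0, 3, 0]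

theorem edgeIncMatrix_apply (u : V₁) (e : G₁.edgeSet) [Decidable (u ∈ (e : Sym2 V₁))] :
    edgeIncMatrix G₁ u e = if u ∈ (e : Sym2 V₁) then 1 else 0 := by
  rw [edgeIncMatrix, Matrix.submatrix_apply, SimpleGraph.incMatrix_apply']
  refine if_congr ?_ rfl rfl
  exact ⟨fun h => h.2, fun h => ⟨e.2, h⟩⟩

theorem eccentricityMatrix_apply {V : Type*} {G : SimpleGraph V} {u v : V} {d c : ℕ}
    (hd : G.edist u v = d) (hc : min (G.eccent u) (G.eccent v) = c) :
    eccentricityMatrix G u v = if d = c then (d : ℝ) else 0 := by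
  have : G.dist u v = d := by rw [SimpleGraph.dist, hd, ENat.toNat_natCast]
  rw [eccentricityMatrix, Matrix.of_apply, this, hd, hc]
  exact if_congr Nat.cast_inj rfl rfl

/-- For pairs inside G₂ or G₃ the exact distance is not known, only that it is below 3. -/
theorem eccentricityMatrix_apply_of_lt {V : Type*} {G : SimpleGraph V} {u v : V}
    (h : G.edist u v < min (G.eccent u) (G.eccent v)) : eccentricityMatrix G u v = 0 := by
  rw [eccentricityMatrix, Matrix.of_apply, if_neg h.ne]

theorem eccentricityMatrix_comm {V : Type*} (G : SimpleGraph V) (u v : V) :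
    eccentricityMatrix G u v = eccentricityMatrix G v u := by
  simp only [eccentricityMatrix, Matrix.of_apply, min_comm (G.eccent u), G.edist_comm (u := u),
    G.dist_comm (u := u)]

theorem eccentricityMatrix_centralVertexEdgeJoin [Nonempty V₁] [Nonempty V₂] [Nonempty V₃]
    (G₂ : SimpleGraph V₂) (G₃ : SimpleGraph V₃)
    (hdeg : ∀ u, ∃ v, G₁.Adj u v) (htri : G₁.CliqueFree 3)
    (x y : (V₁ ⊕ G₁.edgeSet) ⊕ (V₂ ⊕ V₃)) :
    eccentricityMatrix (centralVertexEdgeJoin G₁ G₂ G₃) x y =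
      nonconstantPart G₁ x y + blockCoeff (blockIndex x) (blockIndex y) := by
  have : Nonempty G₁.edgeSet := by
    obtain ⟨u⟩ := ‹Nonempty V₁›
    obtain ⟨v, hv⟩ := hdeg u
    exact ⟨⟨s(u, v), hv⟩⟩
  have h1 := eccent_vertex G₁ G₂ G₃ hdeg htri
  have h2 := eccent_edge G₁ G₂ G₃ htri
  have h3 := eccent_left G₁ G₂ G₃
  have h4 := eccent_right G₁ G₂ G₃ hdeg
  have h22 : min (2 : ℕ∞) 2 = (2 : ℕ) := by norm_num
  have h23 : min (2 : ℕ∞) 3 = (2 : ℕ) := by norm_num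
  have h33 : min (3 : ℕ∞) 3 = (3 : ℕ) := by norm_num
  have ve (u : V₁) (e : G₁.edgeSet) :
      eccentricityMatrix (centralVertexEdgeJoin G₁ G₂ G₃) (.inl (.inl u)) (.inl (.inr e)) =
        -2 * edgeIncMatrix G₁ u e + 2 := by
    have hc := (congrArg₂ min (h1 u) (h2 e)).trans h22
    rw [edgeIncMatrix_apply]
    split_ifs with h
    · rw [eccentricityMatrix_apply (d := 1) (edist_vertex_edge_of_mem _ _ _ h) hc]; norm_num
    · rw [eccentricityMatrix_apply (d := 2) (edist_vertex_edge _ _ _ htri h) hc]; norm_num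
  have va (u : V₁) (a : V₂) :
      eccentricityMatrix (centralVertexEdgeJoin G₁ G₂ G₃) (.inl (.inl u)) (.inr (.inl a)) = 0 := by
    have hc := (congrArg₂ min (h1 u) (h3 a)).trans h23
    rw [eccentricityMatrix_apply (d := 1) (edist_vertex_left _ _ _ u a) hc]; norm_num
  have vb (u : V₁) (b : V₃) :
      eccentricityMatrix (centralVertexEdgeJoin G₁ G₂ G₃) (.inl (.inl u)) (.inr (.inr b)) = 2 := by
    have hc := (congrArg₂ min (h1 u) (h4 b)).trans h23
    rw [eccentricityMatrix_apply (d := 2) (edist_vertex_right _ _ _ hdeg u b) hc]; norm_num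
  have ea (e : G₁.edgeSet) (a : V₂) :
      eccentricityMatrix (centralVertexEdgeJoin G₁ G₂ G₃) (.inl (.inr e)) (.inr (.inl a)) = 2 := by
    have hc := (congrArg₂ min (h2 e) (h3 a)).trans h23
    rw [eccentricityMatrix_apply (d := 2) (edist_edge_left _ _ _ e a) hc]; norm_num
  have eb (e : G₁.edgeSet) (b : V₃) :
      eccentricityMatrix (centralVertexEdgeJoin G₁ G₂ G₃) (.inl (.inr e)) (.inr (.inr b)) = 0 := by
    have hc := (congrArg₂ min (h2 e) (h4 b)).trans h23
    rw [eccentricityMatrix_apply (d := 1) (edist_edge_right _ _ _ e b) hc]; norm_num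
  have ab (a : V₂) (b : V₃) :
      eccentricityMatrix (centralVertexEdgeJoin G₁ G₂ G₃) (.inr (.inl a)) (.inr (.inr b)) = 3 := by
    have hc := (congrArg₂ min (h3 a) (h4 b)).trans h33
    rw [eccentricityMatrix_apply (d := 3) (edist_left_right _ _ _ a b) hc]; norm_num
  have h2lt3 : (2 : ℕ∞) < 3 := by norm_num
  rcases x with ((u | e) | (a | b)) <;> rcases y with ((v | f) | (c | d))
  · have hc := (congrArg₂ min (h1 u) (h1 v)).trans h22
    suffices eccentricityMatrix (centralVertexEdgeJoin G₁ G₂ G₃) (.inl (.inl u)) (.inl (.inl v)) =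
        2 * G₁.adjMatrix ℝ u v by simpa [nonconstantPart, blockIndex, blockCoeff] using this
    rw [SimpleGraph.adjMatrix_apply]
    split_ifs with h
    · rw [eccentricityMatrix_apply (d := 2) (edist_vertex_vertex _ _ _ h) hc]; norm_num
    · by_cases hne : u = v
      · subst hne
        rw [eccentricityMatrix_apply (d := 0) (by simp) hc]; norm_num
      · rw [eccentricityMatrix_apply (d := 1) (edist_vertex_vertex_of_not_adj _ _ _ hne h) hc]
        norm_num
  · simp [ve, nonconstantPart, blockIndex, blockCoeff]
  · simp [va, nonconstantPart, blockIndex, blockCoeff]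
  · simp [vb, nonconstantPart, blockIndex, blockCoeff]
  · rw [eccentricityMatrix_comm]
    simp [ve, nonconstantPart, blockIndex, blockCoeff]
  · have hc := (congrArg₂ min (h2 e) (h2 f)).trans h22
    by_cases h : e = f
    · subst h
      rw [eccentricityMatrix_apply (d := 0) (by simp) hc]
      simp [nonconstantPart, blockIndex, blockCoeff]
    · rw [eccentricityMatrix_apply (d := 2) (edist_edge_edge _ _ _ h) hc]
      simp [nonconstantPart, blockIndex, blockCoeff, h]
  · simp [ea, nonconstantPart, blockIndex, blockCoeff]
  · simp [eb, nonconstantPart, blockIndex, blockCoeff]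
  · rw [eccentricityMatrix_comm]
    simp [va, nonconstantPart, blockIndex, blockCoeff]
  · rw [eccentricityMatrix_comm]
    simp [ea, nonconstantPart, blockIndex, blockCoeff]
  · rw [eccentricityMatrix_apply_of_lt]
    · simp [nonconstantPart, blockIndex, blockCoeff]
    · rw [h3, h3, min_self]
      exact (edist_left_left_le _ _ _ a c).trans_lt h2lt3
  · simp [ab, nonconstantPart, blockIndex, blockCoeff]
  · rw [eccentricityMatrix_comm]
    simp [vb, nonconstantPart, blockIndex, blockCoeff]
  · rw [eccentricityMatrix_comm]
    simp [eb, nonconstantPart, blockIndex, blockCoeff]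
  · rw [eccentricityMatrix_comm]
    simp [ab, nonconstantPart, blockIndex, blockCoeff]
  · rw [eccentricityMatrix_apply_of_lt]
    · simp [nonconstantPart, blockIndex, blockCoeff]
    · rw [h4, h4, min_self]
      exact (edist_right_right_le _ _ _ b d).trans_lt h2lt3

end Matrices

theorem eval_charpoly_eq_det {n : Type*} [Fintype n] [DecidableEq n] (M : Matrix n n ℝ) (t : ℝ) :
    M.charpoly.eval t = (t • 1 - M).det := by
  rw [Matrix.eval_charpoly, Matrix.scalar_apply, Matrix.smul_one_eq_diagonal]

/-! ### Incidence matrix of a regular graph -/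

section Incidence

variable {V₁ : Type*} [Fintype V₁] (G₁ : SimpleGraph V₁) [DecidableRel G₁.Adj]

/-- Transfers sums from `incMatrix`, whose columns run over all of `Sym2 V₁` and vanish off the edge
set. -/
theorem sum_edgeSet_eq_sum_sym2 (f : Sym2 V₁ → ℝ) (hf : ∀ e ∉ G₁.edgeSet, f e = 0) :
    ∑ e : G₁.edgeSet, f e = ∑ e, f e := by
  rw [← Finset.sum_subset (Finset.subset_univ G₁.edgeFinset)
    fun e _ he => hf e fun h => he (SimpleGraph.mem_edgeFinset.2 h)]
  exact (Finset.sum_subtype G₁.edgeFinset (fun e => SimpleGraph.mem_edgeFinset) f).symm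

theorem edgeIncMatrix_mul_transpose [DecidableEq V₁] {r : ℕ} (hG : G₁.IsRegularOfDegree r) :
    edgeIncMatrix G₁ * (edgeIncMatrix G₁).transpose = G₁.adjMatrix ℝ + (r : ℝ) • 1 := by
  have h : edgeIncMatrix G₁ * (edgeIncMatrix G₁).transpose =
      G₁.incMatrix ℝ * (G₁.incMatrix ℝ).transpose := by
    ext u v
    exact sum_edgeSet_eq_sum_sym2 G₁ (fun e => G₁.incMatrix ℝ u e * G₁.incMatrix ℝ v e)
      fun e he => by rw [G₁.incMatrix_of_notMem_incidenceSet fun h => he h.1, zero_mul]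
  rw [h, SimpleGraph.incMatrix_mul_transpose]
  ext u v
  by_cases huv : u = v
  · subst huv
    simp [hG.degree_eq u]
  · simp [huv, SimpleGraph.adjMatrix_apply]

theorem sum_edgeIncMatrix_row [DecidableEq V₁] {r : ℕ} (hG : G₁.IsRegularOfDegree r) (u : V₁) :
    ∑ e, edgeIncMatrix G₁ u e = r := by
  refine (sum_edgeSet_eq_sum_sym2 G₁ (fun e => G₁.incMatrix ℝ u e)
    fun e he => G₁.incMatrix_of_notMem_incidenceSet fun h => he h.1).trans ?_
  rw [SimpleGraph.sum_incMatrix_apply, hG.degree_eq u]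

theorem sum_edgeIncMatrix_column [DecidableEq V₁] (e : G₁.edgeSet) :
    ∑ u, edgeIncMatrix G₁ u e = 2 :=
  G₁.sum_incMatrix_apply_of_mem_edgeSet e.2

theorem sum_adjMatrix_row {r : ℕ} (hG : G₁.IsRegularOfDegree r) (u : V₁) :
    ∑ v, G₁.adjMatrix ℝ u v = r := by
  simpa [Matrix.mulVec, dotProduct] using
    G₁.adjMatrix_mulVec_const_apply_of_regular (α := ℝ) (a := 1) hG (v := u)

end Incidence

/-! ### Quotient by the four kinds of vertices -/

/-- The indicator matrix of the partition of the vertices of the join into four kinds. -/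
def blockIndicator (α β γ δ : Type*) : Matrix ((α ⊕ β) ⊕ (γ ⊕ δ)) (Fin 4) ℝ :=
  Matrix.of fun x i => if blockIndex x = i then 1 else 0

/-- The rows of the part of the eccentricity matrix of the join that is constant on blocks. -/
def blockRows (α β γ δ : Type*) : Matrix (Fin 4) ((α ⊕ β) ⊕ (γ ⊕ δ)) ℝ :=
  Matrix.of fun i x => blockCoeff i (blockIndex x)

/-- The action of the nonconstant part on the span of the block indicators. -/
def nonconstantQuotient (r : ℝ) : Matrix (Fin 4) (Fin 4) ℝ :=
  !![2 * r, -2 * r, 0, 0;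
     -4, -2, 0, 0;
     0, 0, 0, 0;
     0, 0, 0, 0]

theorem nonconstantQuotient_add_mul {V₁ V₂ V₃ : Type*} [Fintype V₁] [Fintype V₂] [Fintype V₃]
    (G₁ : SimpleGraph V₁) [DecidableRel G₁.Adj] (r : ℝ) :
    nonconstantQuotient r + blockRows V₁ G₁.edgeSet V₂ V₃ *
        blockIndicator V₁ G₁.edgeSet V₂ V₃ =
      quotientMatrix (Fintype.card V₁) G₁.edgeFinset.card r (Fintype.card V₂)
        (Fintype.card V₃) := by
  ext i j
  simp only [Matrix.add_apply, Matrix.mul_apply, Fintype.sum_sum_type, blockRows, blockIndicator,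
    Matrix.of_apply]
  fin_cases i <;> fin_cases j <;>
    simp [blockIndex, blockCoeff, nonconstantQuotient, quotientMatrix, SimpleGraph.edgeFinset_card] <;> ring

/-- The quadratic is the factor t² - (2x - 2)t - 4(2x + r) at x = r, which is what later cancels. -/
theorem det_smul_one_sub_nonconstantQuotient (r t : ℝ) :
    (t • 1 - nonconstantQuotient r).det = t ^ 2 * (t ^ 2 - (2 * r - 2) * t - 12 * r) := by
  have : t • 1 - nonconstantQuotient r =
      !![t - 2 * r, 2 * r, 0, 0; 4, t + 2, 0, 0; 0, 0, t, 0; 0, 0, 0, t] := by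
    ext i j
    fin_cases i <;> fin_cases j <;> simp [nonconstantQuotient]
  rw [this]
  simp [Matrix.det_succ_row_zero, Fin.sum_univ_succ, Fin.succAbove]
  ring

/-! ### Characteristic polynomial of the join -/

section Spectrum

variable {V₁ V₂ V₃ : Type*} [DecidableEq V₁] (G₁ : SimpleGraph V₁) [DecidableRel G₁.Adj]

theorem eccentricityMatrix_eq_nonconstantPart_add [Nonempty V₁] [Nonempty V₂] [Nonempty V₃]
    (G₂ : SimpleGraph V₂) (G₃ : SimpleGraph V₃)
    (hdeg : ∀ u, ∃ v, G₁.Adj u v) (htri : G₁.CliqueFree 3) :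
    eccentricityMatrix (centralVertexEdgeJoin G₁ G₂ G₃) =
      nonconstantPart G₁ + blockIndicator V₁ G₁.edgeSet V₂ V₃ *
        blockRows V₁ G₁.edgeSet V₂ V₃ := by
  ext x y
  rw [eccentricityMatrix_centralVertexEdgeJoin G₁ G₂ G₃ hdeg htri, Matrix.add_apply,
    Matrix.mul_apply]
  simp [blockIndicator, blockRows]

variable [Fintype V₁] [Fintype V₂] [Fintype V₃]

/-- The partition is equitable: rows of A and of R sum to `r`, columns of R to 2. -/
theorem nonconstantPart_mul_blockIndicator {r : ℕ} (hG : G₁.IsRegularOfDegree r) :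
    nonconstantPart (V₂ := V₂) (V₃ := V₃) G₁ * blockIndicator V₁ G₁.edgeSet V₂ V₃ =
      blockIndicator V₁ G₁.edgeSet V₂ V₃ * nonconstantQuotient r := by
  have hA := sum_adjMatrix_row G₁ hG
  have hR := sum_edgeIncMatrix_row G₁ hG
  have hC := sum_edgeIncMatrix_column G₁
  ext x i
  simp only [Matrix.mul_apply, Fintype.sum_sum_type, Fin.sum_univ_four, nonconstantPart,
    blockIndicator, Matrix.of_apply]
  rcases x with ((u | e) | (a | b)) <;> fin_cases i <;>
    simp [-SimpleGraph.adjMatrix_apply, blockIndex, nonconstantQuotient, ← Finset.mul_sum, hA, hR,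
      hC, Matrix.one_apply]
  norm_num

variable [DecidableEq V₂] [DecidableEq V₃]

theorem det_smul_one_sub_nonconstantPart {r : ℕ} (hG : G₁.IsRegularOfDegree r) (s : Multiset ℝ)
    (hs : (G₁.adjMatrix ℝ).charpoly = (s.map fun a => X - C a).prod) (t : ℝ) :
    (t • 1 - nonconstantPart (V₂ := V₂) (V₃ := V₃) G₁).det * (t + 2) ^ Fintype.card V₁ =
      t ^ (Fintype.card V₂ + Fintype.card V₃) * (t + 2) ^ G₁.edgeFinset.card *
        (s.map fun x => t ^ 2 - (2 * x - 2) * t - 4 * (2 * x + r)).prod := by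
  have h : t • 1 - nonconstantPart (V₂ := V₂) (V₃ := V₃) G₁ =
      Matrix.fromBlocks
        (Matrix.fromBlocks (t • 1 - (2 : ℝ) • G₁.adjMatrix ℝ) ((2 : ℝ) • edgeIncMatrix G₁)
          ((2 : ℝ) • (edgeIncMatrix G₁).transpose) ((t + 2) • 1)) 0 0 (t • 1) := by
    rw [nonconstantPart, ← Matrix.fromBlocks_one, ← Matrix.fromBlocks_one,
      Matrix.fromBlocks_smul, Matrix.fromBlocks_smul, sub_eq_add_neg, Matrix.fromBlocks_neg,
      Matrix.fromBlocks_neg, Matrix.fromBlocks_add, Matrix.fromBlocks_add]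
    simp [sub_eq_add_neg, add_smul]
  -- The Schur complement is a polynomial in A alone, since RRᵀ = A + rI.
  have h' : (t + 2) • (t • 1 - (2 : ℝ) • G₁.adjMatrix ℝ) -
      (2 : ℝ) • edgeIncMatrix G₁ * (2 : ℝ) • (edgeIncMatrix G₁).transpose =
      (t ^ 2 + 2 * t - 4 * r) • (1 : Matrix V₁ V₁ ℝ) - (2 * t + 8) • G₁.adjMatrix ℝ := by
    rw [Matrix.smul_mul, Matrix.mul_smul, edgeIncMatrix_mul_transpose G₁ hG]
    module
  rw [h, Matrix.det_fromBlocks_zero₂₁, mul_right_comm, det_fromBlocks_smul_one_mul_pow, h',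
    det_smul_one_sub_smul _ s hs, Matrix.det_smul, Matrix.det_one, Fintype.card_sum,
    SimpleGraph.edgeFinset_card]
  have : s.map (fun x => t ^ 2 + 2 * t - 4 * r - (2 * t + 8) * x) =
      s.map fun x => t ^ 2 - (2 * x - 2) * t - 4 * (2 * x + r) :=
    Multiset.map_congr rfl fun x _ => by ring
  rw [this]
  ring

/-- The relation between the characteristic polynomials of the eccentricity matrix of the join, of
its quotient matrix, and of the adjacency matrix of the first graph, whose eigenvalues are the
degree `r` and the elements of `s`. -/
theorem charpoly_eccentricityMatrix_mul [Nonempty V₁] [Nonempty V₂] [Nonempty V₃]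
    (G₂ : SimpleGraph V₂) (G₃ : SimpleGraph V₃)
    {r : ℕ} (hG : G₁.IsRegularOfDegree r) (hr : 1 ≤ r) (htri : G₁.CliqueFree 3) (s : Multiset ℝ)
    (hs : (G₁.adjMatrix ℝ).charpoly = (((r : ℝ) ::ₘ s).map fun a => X - C a).prod) :
    (eccentricityMatrix (centralVertexEdgeJoin G₁ G₂ G₃)).charpoly *
        (X + 2) ^ Fintype.card V₁ =
      X ^ (Fintype.card V₂ + Fintype.card V₃ - 2) * (X + 2) ^ G₁.edgeFinset.card *
        (s.map fun x : ℝ => X ^ 2 - C (2 * x - 2) * X - C (4 * (2 * x + r))).prod *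
        (quotientMatrix (Fintype.card V₁) G₁.edgeFinset.card r (Fintype.card V₂)
          (Fintype.card V₃)).charpoly := by
  have hdeg (u : V₁) : ∃ v, G₁.Adj u v := by
    rw [← SimpleGraph.degree_pos_iff_exists_adj, hG.degree_eq u]
    exact hr
  have hcard : Fintype.card V₂ + Fintype.card V₃ = Fintype.card V₂ + Fintype.card V₃ - 2 + 2 := by
    have := Fintype.card_pos (α := V₂)
    have := Fintype.card_pos (α := V₃)
    omega
  have hne : (X ^ 2 * (X ^ 2 - C (2 * (r : ℝ) - 2) * X - C (12 * (r : ℝ))) : ℝ[X]) ≠ 0 := by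
    refine mul_ne_zero (pow_ne_zero 2 X_ne_zero) ?_
    have : (X ^ 2 - C (2 * (r : ℝ) - 2) * X - C (12 * (r : ℝ)) : ℝ[X]).Monic := by monicity!
    exact this.ne_zero
  -- The common factor χ_B may vanish at some `t`, so it is cancelled as a polynomial; only the
  -- multiplied identity is checked pointwise.
  refine mul_right_cancel₀ hne (Polynomial.funext fun t => ?_)
  have hSU : (t • 1 - nonconstantPart (V₂ := V₂) (V₃ := V₃) G₁) *
      blockIndicator V₁ G₁.edgeSet V₂ V₃ =
      blockIndicator V₁ G₁.edgeSet V₂ V₃ * (t • 1 - nonconstantQuotient r) := by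
    rw [Matrix.sub_mul, Matrix.mul_sub, nonconstantPart_mul_blockIndicator G₁ hG]
    simp
  have key := det_sub_mul_mul_det _ _ (blockRows V₁ G₁.edgeSet V₂ V₃) _ hSU
  rw [sub_sub, sub_sub, nonconstantQuotient_add_mul,
    ← eccentricityMatrix_eq_nonconstantPart_add G₁ G₂ G₃ hdeg htri,
    det_smul_one_sub_nonconstantQuotient, ← eval_charpoly_eq_det,
    ← eval_charpoly_eq_det, ← eval_charpoly_eq_det] at key
  have hN := det_smul_one_sub_nonconstantPart (V₂ := V₂) (V₃ := V₃) G₁ hG _ hs t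
  rw [Multiset.map_cons, Multiset.prod_cons, ← eval_charpoly_eq_det] at hN
  have hpow : t ^ (Fintype.card V₂ + Fintype.card V₃) =
      t ^ (Fintype.card V₂ + Fintype.card V₃ - 2) * t ^ 2 := by rw [← pow_add, ← hcard]
  rw [hpow] at hN
  simp only [eval_mul, eval_pow, eval_add, eval_X, eval_ofNat, eval_sub, eval_C,
    eval_multiset_prod, Multiset.map_map, Function.comp_def]
  linear_combination (t + 2) ^ Fintype.card V₁ * key +
    (quotientMatrix (Fintype.card V₁) G₁.edgeFinset.card r (Fintype.card V₂)
          (Fintype.card V₃)).charpoly.eval t * hN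

end Spectrum

/-! ### Reading off the spectrum -/

theorem quadratic_eq_mul {r x : ℝ} (h : -r ≤ x) :
    (X ^ 2 - C (2 * x - 2) * X - C (4 * (2 * x + r)) : ℝ[X]) =
      (X - C ((-1 + x) + √((1 + x) ^ 2 + 4 * (x + r)))) *
        (X - C ((-1 + x) - √((1 + x) ^ 2 + 4 * (x + r)))) := by
  -- The bound -r ≤ x makes the radicand nonnegative, so `√` is a genuine root and not the default
  -- 0.
  have hsq := Real.sq_sqrt (show 0 ≤ (1 + x) ^ 2 + 4 * (x + r) by nlinarith [sq_nonneg (1 + x)])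
  refine Polynomial.funext fun t => ?_
  simp only [eval_sub, eval_mul, eval_pow, eval_X, eval_C]
  linear_combination hsq

end CentralJoin

open CentralJoin in
theorem theorem3p19 {V₁ V₂ V₃ : Type*}
    [Fintype V₁] [DecidableEq V₁] [Nonempty V₁]
    [Fintype V₂] [DecidableEq V₂] [Nonempty V₂]
    [Fintype V₃] [DecidableEq V₃] [Nonempty V₃]
    (G₁ : SimpleGraph V₁) (G₂ : SimpleGraph V₂) (G₃ : SimpleGraph V₃)
    [DecidableRel G₁.Adj] [DecidableRel G₂.Adj] [DecidableRel G₃.Adj]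
    (p₁ p₂ p₃ q₁ r₁ r₂ r₃ : ℕ)
    (hp₁ : Fintype.card V₁ = p₁) (hp₂ : Fintype.card V₂ = p₂) (hp₃ : Fintype.card V₃ = p₃)
    (hq₁ : G₁.edgeFinset.card = q₁)
    (hG₁ : G₁.IsRegularOfDegree r₁) (hG₂ : G₂.IsRegularOfDegree r₂)
    (hG₃ : G₃.IsRegularOfDegree r₃)
    (hr₁ : 1 ≤ r₁) (htri : G₁.CliqueFree 3)
    -- `lam 1 ≥ lam 2 ≥ … ≥ lam p₁` are the adjacency eigenvalues of `G₁`, with multiplicity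
    (lam : ℕ → ℝ) (hanti : AntitoneOn lam (Set.Icc 1 p₁))
    (hlam : CentralJoin.eigenvalueMultiset (G₁.adjMatrix ℝ)
      = (Finset.Icc 1 p₁).val.map lam) :
    (CentralJoin.centralVertexEdgeJoin G₁ G₂ G₃).Connected ∧
    -- the case where the multiplicity `q₁ - p₁` of `-2` is nonnegative
    (p₁ ≤ q₁ →
      CentralJoin.eccentricitySpectrum (CentralJoin.centralVertexEdgeJoin G₁ G₂ G₃)
        = (∑ j ∈ Finset.Icc 2 p₁,
            ({(-1 + lam j) + √((1 + lam j) ^ 2 + 4 * (lam j + r₁)),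
              (-1 + lam j) - √((1 + lam j) ^ 2 + 4 * (lam j + r₁))} : Multiset ℝ))
          + Multiset.replicate (q₁ - p₁) (-2)
          + Multiset.replicate (p₂ + p₃ - 2) 0
          + CentralJoin.eigenvalueMultiset (CentralJoin.quotientMatrix p₁ q₁ r₁ p₂ p₃)) ∧
    -- the case where it is negative: `p₁ - q₁` copies of `-2` are removed from the list
    (q₁ < p₁ →
      CentralJoin.eccentricitySpectrum (CentralJoin.centralVertexEdgeJoin G₁ G₂ G₃)
          + Multiset.replicate (p₁ - q₁) (-2)
        = (∑ j ∈ Finset.Icc 2 p₁,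
            ({(-1 + lam j) + √((1 + lam j) ^ 2 + 4 * (lam j + r₁)),
              (-1 + lam j) - √((1 + lam j) ^ 2 + 4 * (lam j + r₁))} : Multiset ℝ))
          + Multiset.replicate (p₂ + p₃ - 2) 0
          + CentralJoin.eigenvalueMultiset (CentralJoin.quotientMatrix p₁ q₁ r₁ p₂ p₃)) := by
  subst hp₁ hp₂ hp₃ hq₁
  have hdeg (u : V₁) : ∃ v, G₁.Adj u v := by
    rw [← SimpleGraph.degree_pos_iff_exists_adj, hG₁.degree_eq u]
    exact hr₁
  refine ⟨connected_centralVertexEdgeJoin G₁ G₂ G₃ hdeg htri, ?_⟩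
  have hpos : 1 ≤ Fintype.card V₁ := Fintype.card_pos
  have hbound (j : ℕ) (hj : j ∈ Finset.Icc 1 (Fintype.card V₁)) : |lam j| ≤ r₁ :=
    abs_le_of_mem_eigenvalueMultiset G₁ hG₁ (hlam ▸ Multiset.mem_map_of_mem lam hj)
  have hlam1 : lam 1 = r₁ := by
    obtain ⟨j, hj, hjr⟩ := Multiset.mem_map.1 (hlam ▸ degree_mem_eigenvalueMultiset G₁ hG₁)
    have hj' := Finset.mem_Icc.1 (Finset.mem_def.2 hj)
    refine le_antisymm (le_of_abs_le (hbound 1 (Finset.mem_Icc.2 ⟨le_rfl, hpos⟩))) ?_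
    rw [← hjr]
    exact hanti ⟨le_rfl, hpos⟩ hj' hj'.1
  have hcons : (Finset.Icc 1 (Fintype.card V₁)).val.map lam =
      (r₁ : ℝ) ::ₘ (Finset.Icc 2 (Fintype.card V₁)).val.map lam := by
    rw [← Finset.insert_Icc_succ_left_eq_Icc hpos, Finset.insert_val_of_notMem (by simp),
      Multiset.map_cons, hlam1]
    rfl
  have hs : (G₁.adjMatrix ℝ).charpoly =
      (((r₁ : ℝ) ::ₘ (Finset.Icc 2 (Fintype.card V₁)).val.map lam).map fun a => X - C a).prod := by
    rw [← hcons, ← hlam]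
    -- The listing `hlam` has as many roots as the degree, so the polynomial splits.
    refine (prod_multiset_X_sub_C_of_monic_of_roots_card_eq (Matrix.charpoly_monic _) ?_).symm
    rw [Matrix.charpoly_natDegree_eq_dim, ← eigenvalueMultiset, hlam]
    simp
  have key := charpoly_eccentricityMatrix_mul G₁ G₂ G₃ hG₁ hr₁ htri _ hs
  rw [Multiset.map_map] at key
  have hquad : (Finset.Icc 2 (Fintype.card V₁)).val.map
      ((fun x : ℝ => (X ^ 2 - C (2 * x - 2) * X - C (4 * (2 * x + r₁)) : ℝ[X])) ∘ lam) =
      (Finset.Icc 2 (Fintype.card V₁)).val.map fun j =>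
        (X - C ((-1 + lam j) + √((1 + lam j) ^ 2 + 4 * (lam j + r₁)))) *
        (X - C ((-1 + lam j) - √((1 + lam j) ^ 2 + 4 * (lam j + r₁)))) := by
    refine Multiset.map_congr rfl fun j hj => ?_
    have hj' := Finset.mem_Icc.1 (Finset.mem_def.2 hj)
    exact quadratic_eq_mul (neg_le_of_abs_le (hbound j (Finset.mem_Icc.2 ⟨by omega, hj'.2⟩)))
  rw [hquad] at key
  have h2 : (X + 2 : ℝ[X]) = X - C (-2) := by
    rw [C_neg, sub_neg_eq_add]; rfl
  have hprod : (∏ j ∈ Finset.Icc 2 (Fintype.card V₁),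
        ((X - C ((-1 + lam j) + √((1 + lam j) ^ 2 + 4 * (lam j + r₁)))) *
        (X - C ((-1 + lam j) - √((1 + lam j) ^ 2 + 4 * (lam j + r₁))))) : ℝ[X]) ≠ 0 :=
    Finset.prod_ne_zero_iff.2 fun j _ => mul_ne_zero (X_sub_C_ne_zero _) (X_sub_C_ne_zero _)
  have hX (n : ℕ) (a : ℝ) : ((X - C a) ^ n : ℝ[X]) ≠ 0 := pow_ne_zero n (X_sub_C_ne_zero a)
  have hroots := congrArg roots key
  rw [h2, show (X : ℝ[X]) ^ (Fintype.card V₂ + Fintype.card V₃ - 2) =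
      (X - C 0) ^ (Fintype.card V₂ + Fintype.card V₃ - 2) by simp] at hroots
  change _ = roots (_ * (∏ j ∈ Finset.Icc 2 (Fintype.card V₁), _) * _) at hroots
  have hprodroots : roots (∏ j ∈ Finset.Icc 2 (Fintype.card V₁),
        ((X - C ((-1 + lam j) + √((1 + lam j) ^ 2 + 4 * (lam j + r₁)))) *
        (X - C ((-1 + lam j) - √((1 + lam j) ^ 2 + 4 * (lam j + r₁))))) : ℝ[X]) =
      ∑ j ∈ Finset.Icc 2 (Fintype.card V₁),
        ({(-1 + lam j) + √((1 + lam j) ^ 2 + 4 * (lam j + r₁)),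
          (-1 + lam j) - √((1 + lam j) ^ 2 + 4 * (lam j + r₁))} : Multiset ℝ) := by
    rw [roots_prod _ _ hprod]
    refine Finset.sum_congr rfl fun j _ => ?_
    rw [roots_mul (mul_ne_zero (X_sub_C_ne_zero _) (X_sub_C_ne_zero _)), roots_X_sub_C,
      roots_X_sub_C]
    rfl
  rw [roots_mul (mul_ne_zero (Matrix.charpoly_monic _).ne_zero (hX _ _)),
    roots_mul (mul_ne_zero (mul_ne_zero (mul_ne_zero (hX _ _) (hX _ _)) hprod)
      (Matrix.charpoly_monic _).ne_zero),
    roots_mul (mul_ne_zero (mul_ne_zero (hX _ _) (hX _ _)) hprod),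
    roots_mul (mul_ne_zero (hX _ _) (hX _ _)), hprodroots, roots_pow, roots_pow,
    roots_pow, roots_X_sub_C, roots_X_sub_C, Multiset.nsmul_singleton, Multiset.nsmul_singleton,
    Multiset.nsmul_singleton] at hroots
  simp only [eccentricitySpectrum, eigenvalueMultiset]
  refine ⟨fun hle => ?_, fun hlt => ?_⟩
  -- The p₁ copies of -2 on the left cancel after splitting q₁ as (q₁ - p₁) + p₁; in the other case
  -- p₁ is split and q₁ copies cancel.
  · refine add_right_cancel (hroots.trans ?_)
    nth_rw 1 [← Nat.sub_add_cancel hle]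
    rw [Multiset.replicate_add]
    abel
  · nth_rw 1 [← Nat.sub_add_cancel hlt.le] at hroots
    rw [Multiset.replicate_add, ← add_assoc] at hroots
    refine add_right_cancel (hroots.trans ?_)
    abel
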